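/- Let $n\ge 1$, $k\ge 0$ be integers and $\kappa,\rho>0$. Index vectors and matrices from $0$. **FFT prefix-sum mechanism.** Let $A\in\mathbb R^{n\times n}$ be the prefix-sum matrix (ones on and below the diagonal). Let $v=(1,\dots,1,0,\dots,0)$ with $n$ ones and $n$ zeros, let $A_{\rm circ}\in\mathbb R^{2n\times 2n}$ be the circulant matrix with first column $v$, let $\hat v_r=\sum_{a=0}^{2n-1}v_a e^{-2\pi \mathrm i ra/(2n)}$ be the discrete Fourier transform of $v$, let $F=\frac1{\sqrt{2n}}\big(e^{-2\pi \mathrm i ra/(2n)}\big)_{r,a}$, and let $\Sigma=\mathrm{diag}(\hat v)$, with $\Sigma^{1/2}$ the entrywise principal square root of the diagonal. On input $x\in\mathbb R^n$ the mechanism outputs $$\Big(\sum_{a\le i}x_a+\mathrm{Re}\,\tilde z_i\Big)_{0\le i<n},\qquad \tilde z=\sqrt{\frac{\kappa^2\|\hat v\|_1}{4n\rho}}\;F^*\Sigma^{1/2}w ,$$ where $w\in\mathbb C^{2n}$ is a standard complex normal vector: the real and imaginary parts of all its entries are independent $N(0,1)$ variables. **Neighbouring streams.** Let $\Pi$ be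 a participation schema, i.e. a set of subsets (participation patterns) of $\{0,\dots,n-1\}$. Streams $x,x'\in\mathbb R^n$ are neighbouring if there is $\pi\in\Pi$ with $x_i=x'_i$ for $i\notin\pi$ and $|x_i-x'_i|\le\kappa$ for $i\in\pi$. **Adaptive streams.** An adaptive stream is a family of measurable functions giving the entry $x_i$ in terms of the outputs released on steps $0,\dots,i-1$; the mechanism is run on it step by step, step $i$ releasing $\sum_{a\le i}x_a+\mathrm{Re}\,\tilde z_i$. Two adaptive streams are neighbouring if for every sequence of released outputs the two resulting streams are neighbouring. **zCDP.** A mechanism $M$ is $\rho'$-zCDP if for all neighbouring inputs $x,x'$ and all $\alpha\in(1,\infty)$ the Rényi divergence satisfies $D_\alpha(M(x)\,\|\,M(x'))\le\rho'\alpha$. **Theorem.** Suppose that every $\pi\in\Pi$ has at most $k$ elements (at most $k$ participations). One has $A_{\rm circ}=(F^*\Sigma^{1/2})(\Sigma^{1/2}F)$, and the upper left $n\times n$ block of $A_{\rm circ}$ is $A$. The FFT prefix-sum mechanism is $(k^2\rho)$-zCDP, both for streams fixed in advance and when run on adaptively chosen streams, where the output is the whole sequence of released values. -/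

import Mathlib

open MeasureTheory ProbabilityTheory

namespace FFTPrefixSum

noncomputable section

/-! ### Rényi divergence and zero-concentrated differential privacy -/

/-- The Rényi divergence `D_α(P ‖ Q) = (α - 1)⁻¹ log ∫ (dP/dQ)^α dQ` of order `α > 1`,
with value `+∞` when `P` is not absolutely continuous with respect to `Q`. -/
def renyiDiv {Ω : Type*} [MeasurableSpace Ω] (α : ℝ) (P Q : Measure Ω) : EReal :=
  open scoped Classical in
  if P ≪ Q then
    (((α - 1)⁻¹ : ℝ) : EReal) * ENNReal.log (∫⁻ ω, (P.rnDeriv Q ω) ^ α ∂Q)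
  else ⊤

/-- A mechanism `M`, given by the law `M x` of its output on each input `x`, is `ρ`-zCDP with
respect to a neighbouring relation on inputs if `D_α(M x ‖ M x') ≤ ρ α` for all neighbouring
`x, x'` and all `α ∈ (1, ∞)`. -/
def IsZCDP {D Ω : Type*} [MeasurableSpace Ω] (Neighbor : D → D → Prop) (M : D → Measure Ω)
    (ρ : ℝ) : Prop :=
  ∀ x x' : D, Neighbor x x' → ∀ α : ℝ, 1 < α → renyiDiv α (M x) (M x') ≤ ((ρ * α : ℝ) : EReal)

/-! ### Streams, participation schemas, neighbouring streams -/

/-- Two streams are neighbouring for the participation schema `Π` and the per-step bound `κ` if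
they differ only on the steps of one participation pattern of `Π`, by at most `κ` on each step. -/
def NeighboringStreams {n : ℕ} (Pi : Set (Finset (Fin n))) (κ : ℝ) (x x' : Fin n → ℝ) : Prop :=
  ∃ π ∈ Pi, (∀ i ∉ π, x i = x' i) ∧ ∀ i ∈ π, |x i - x' i| ≤ κ

/-- An adaptively chosen stream: the entry of step `i` is a measurable function of the outputs
that the mechanism has released on the steps before `i`. -/
structure AdaptiveStream (n : ℕ) where
  entry : (i : Fin n) → (Fin i → ℝ) → ℝ
  measurable_entry : ∀ i, Measurable (entry i)

/-- The stream that results from an adaptive choice when the released outputs are `y`. -/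
def AdaptiveStream.streamOn {n : ℕ} (a : AdaptiveStream n) (y : Fin n → ℝ) : Fin n → ℝ :=
  fun i => a.entry i (fun l => y ⟨l, l.2.trans i.2⟩)

/-- Two adaptive streams are neighbouring if, whatever outputs are released, the resulting
streams are neighbouring. -/
def NeighboringAdaptiveStreams {n : ℕ} (Pi : Set (Finset (Fin n))) (κ : ℝ)
    (a a' : AdaptiveStream n) : Prop :=
  ∀ y : Fin n → ℝ, NeighboringStreams Pi κ (a.streamOn y) (a'.streamOn y)

/-! ### The prefix-sum matrix, its circulant embedding, and the Fourier transform -/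

/-- The prefix-sum matrix: ones on and below the diagonal. -/
def prefixSumMatrix (n : ℕ) : Matrix (Fin n) (Fin n) ℝ :=
  Matrix.of fun i j => if j ≤ i then 1 else 0

/-- The vector `v = (1, …, 1, 0, …, 0)` with `n` ones and `n` zeros. -/
def embVec (n : ℕ) : Fin (2 * n) → ℝ := fun a => if (a : ℕ) < n then 1 else 0

/-- The inclusion of the first `n` indices. -/
def firstHalf {n : ℕ} (i : Fin n) : Fin (2 * n) := Fin.castLE (by omega) i

/-- The circulant matrix with first column `v`. -/
def circMatrix (n : ℕ) : Matrix (Fin (2 * n)) (Fin (2 * n)) ℝ := Matrix.circulant (embVec n)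

/-- The (unnormalised) discrete Fourier transform of `v`. -/
def vDFT (n : ℕ) (k : Fin (2 * n)) : ℂ :=
  ∑ a : Fin (2 * n),
    (embVec n a : ℂ) * Complex.exp (-(Complex.I * 2 * Real.pi * (k : ℕ) * (a : ℕ)) / (2 * n))

/-- The unitary DFT matrix `F` in dimension `2n`. -/
def dftMatrix (n : ℕ) : Matrix (Fin (2 * n)) (Fin (2 * n)) ℂ :=
  Matrix.of fun k a =>
    ((1 / Real.sqrt (2 * n) : ℝ) : ℂ) *
      Complex.exp (-(Complex.I * 2 * Real.pi * (k : ℕ) * (a : ℕ)) / (2 * n))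

/-- `Σ^{1/2}` for `Σ = diag(DFT v)`, with the principal square root (which is `0` at `0`). -/
def sqrtSigma (n : ℕ) : Matrix (Fin (2 * n)) (Fin (2 * n)) ℂ :=
  Matrix.diagonal fun k => vDFT n k ^ (1 / 2 : ℂ)

/-- The factor (decoder) `F* Σ^{1/2}`. -/
def decoder (n : ℕ) : Matrix (Fin (2 * n)) (Fin (2 * n)) ℂ :=
  (dftMatrix n).conjTranspose * sqrtSigma n

/-- The factor (encoder) `Σ^{1/2} F`. -/
def encoder (n : ℕ) : Matrix (Fin (2 * n)) (Fin (2 * n)) ℂ := sqrtSigma n * dftMatrix n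

/-! ### The mechanism -/

/-- The standard complex normal law on `ℂ`: independent `N(0,1)` real and imaginary parts. -/
def stdComplexNormal : Measure ℂ :=
  ((gaussianReal 0 1).prod (gaussianReal 0 1)).map Complex.measurableEquivRealProd.symm

/-- The law of a standard complex normal vector of length `2n`. -/
def stdComplexNormalVec (n : ℕ) : Measure (Fin (2 * n) → ℂ) :=
  Measure.pi fun _ => stdComplexNormal

/-- The noise scale `√(κ² ‖DFT v‖₁ / (4 n ρ))`. -/
def noiseScale (n : ℕ) (κ ρ : ℝ) : ℝ :=
  Real.sqrt (κ ^ 2 * (∑ k : Fin (2 * n), ‖vDFT n k‖) / (4 * n * ρ))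

/-- The noise added to the prefix sums, as a function of the complex vector `w`: the real part of
the first `n` coordinates of `√(κ² ‖DFT v‖₁ / (4 n ρ)) · F* Σ^{1/2} w`. -/
def fftNoise (n : ℕ) (κ ρ : ℝ) (w : Fin (2 * n) → ℂ) : Fin n → ℝ :=
  fun i => ((noiseScale n κ ρ : ℂ) * (decoder n).mulVec w (firstHalf i)).re

/-- The law of the output of the FFT prefix-sum mechanism on the stream `x`. -/
def fftMechanism (n : ℕ) (κ ρ : ℝ) (x : Fin n → ℝ) : Measure (Fin n → ℝ) :=
  (stdComplexNormalVec n).map fun w i => (∑ a ∈ Finset.Iic i, x a) + fftNoise n κ ρ w i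

/-- The outputs released in the interaction with an adaptive stream when the noise is `z`: on
step `i` the prefix sum of the entries chosen on the steps `0, …, i`, plus `z i`; the entry of
step `j` is chosen on the basis of the outputs of the steps before `j`. -/
def transcript {n : ℕ} (a : AdaptiveStream n) (z : Fin n → ℝ) (i : Fin n) : ℝ :=
  (∑ j : Fin ((i : ℕ) + 1),
    a.entry ⟨j, by omega⟩ (fun l : Fin (j : ℕ) => transcript a z ⟨l, by omega⟩)) + z i
termination_by (i : ℕ)
decreasing_by
  have h1 := j.2
  have h2 := l.2
  omega

/-- The law of all outputs of the FFT prefix-sum mechanism when it is run, step by step, on an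
adaptively chosen stream. -/
def adaptiveFFTMechanism (n : ℕ) (κ ρ : ℝ) (a : AdaptiveStream n) : Measure (Fin n → ℝ) :=
  (stdComplexNormalVec n).map fun w => transcript a (fftNoise n κ ρ w)

end

end FFTPrefixSum

namespace FFTPrefixSum

open scoped Matrix ENNReal

/-! ### Characteristic functions of the Gaussian laws -/

/-! The noise is `Re (N w)`, where `N` is `noiseScale` times the first `n` rows of the decoder. It
is a nondegenerate Gaussian vector, so it is distributed as `T g` with `T` square and invertible,
and has density proportional to `exp (-|W z|² / 2)` with `W = T⁻¹` (`exists_map_gaussian_eq`).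

For an adaptive stream, output `i` is `z i` plus a function of the earlier outputs. The map from
noise to transcript is therefore triangular with unit diagonal and preserves volume, and the output
density at `y` is the noise density at `y - a.prefixSum y`. Completing the square at fixed `y`
bounds `(p / p') ^ α * p'` by a constant times the output density of the stream `α a + (1 - α) a'`,
which has integral `1` (`outputDensity_rpow_le`). Hence `D_α ≤ (α / 2) sup_y |W Δ y|²`, with `Δ` the
difference of prefix sums, exactly as without adaptivity.

To bound `|W Δ|²`: whitening is no longer than any `h` with `Re (N h) = Δ` (`whitened_le`). Since
decoder times encoder restricts to the prefix-sum matrix, `h` can be the encoder applied to the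
stream difference, divided by `noiseScale`. Entries in row `r` of the encoder all have squared
modulus `‖vDFT n r‖ / (2 n)`, which gives `|h|² ≤ 2 k² ρ`. -/

lemma integral_cexp_mul_gaussianReal (b : ℝ) :
    ∫ x, Complex.exp ((b * x : ℝ) * Complex.I) ∂gaussianReal 0 1 =
      Complex.exp (-((b ^ 2 : ℝ) : ℂ) / 2) := by
  have h := charFun_gaussianReal (μ := 0) (v := 1) b
  rw [charFun_apply_real] at h
  simp only [Complex.ofReal_mul, h]
  congr 1
  push_cast
  ring

lemma integral_cexp_pi_gaussianReal {ι : Type*} [Fintype ι] (b : ι → ℝ) :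
    ∫ x, Complex.exp ((∑ i, b i * x i : ℝ) * Complex.I) ∂Measure.pi (fun _ : ι => gaussianReal 0 1) =
      Complex.exp (-((∑ i, b i ^ 2 : ℝ) : ℂ) / 2) := by
  have h := integral_fintype_prod_eq_prod (𝕜 := ℂ) (μ := fun _ : ι => gaussianReal 0 1)
    (fun i (x : ℝ) => Complex.exp ((b i * x : ℝ) * Complex.I))
  simp only [integral_cexp_mul_gaussianReal, ← Complex.exp_sum, ← Finset.sum_mul,
    ← Complex.ofReal_sum, ← Finset.sum_div, Finset.sum_neg_distrib] at h
  exact h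

instance : IsProbabilityMeasure stdComplexNormal :=
  Measure.isProbabilityMeasure_map (MeasurableEquiv.measurable _).aemeasurable

instance (n : ℕ) : IsProbabilityMeasure (stdComplexNormalVec n) := by
  unfold stdComplexNormalVec; infer_instance

/-- With real and imaginary parts each of variance `1`, the variable `Re (b w) = Re b · x - Im b ·
y` has variance `‖b‖²`, without a factor `1/2`. -/
lemma integral_cexp_re_mul_stdComplexNormal (b : ℂ) :
    ∫ w, Complex.exp (((b * w).re : ℝ) * Complex.I) ∂stdComplexNormal =
      Complex.exp (-((‖b‖ ^ 2 : ℝ) : ℂ) / 2) := by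
  rw [stdComplexNormal, integral_map_equiv]
  have h := integral_prod_mul (μ := gaussianReal 0 1) (ν := gaussianReal 0 1)
    (fun x : ℝ => Complex.exp ((b.re * x : ℝ) * Complex.I))
    (fun x : ℝ => Complex.exp ((-b.im * x : ℝ) * Complex.I))
  rw [integral_cexp_mul_gaussianReal, integral_cexp_mul_gaussianReal, ← Complex.exp_add] at h
  have h2 : -((b.re ^ 2 : ℝ) : ℂ) / 2 + -(((-b.im) ^ 2 : ℝ) : ℂ) / 2 =
      -((‖b‖ ^ 2 : ℝ) : ℂ) / 2 := by
    rw [Complex.sq_norm, Complex.normSq_apply]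
    push_cast
    ring
  rw [← h2, ← h]
  refine integral_congr_ae (Filter.Eventually.of_forall fun p => ?_)
  simp only [← Complex.exp_add, ← add_mul, ← Complex.ofReal_add, Complex.mul_re]
  congr 3
  simp [sub_eq_add_neg]

lemma integral_cexp_re_stdComplexNormalVec {n : ℕ} (b : Fin (2 * n) → ℂ) :
    ∫ w, Complex.exp (((∑ r, b r * w r).re : ℝ) * Complex.I) ∂stdComplexNormalVec n =
      Complex.exp (-((∑ r, ‖b r‖ ^ 2 : ℝ) : ℂ) / 2) := by
  have h := integral_fintype_prod_eq_prod (𝕜 := ℂ) (μ := fun _ : Fin (2 * n) => stdComplexNormal)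
    (fun r (w : ℂ) => Complex.exp (((b r * w).re : ℝ) * Complex.I))
  simp only [integral_cexp_re_mul_stdComplexNormal, ← Complex.exp_sum, ← Finset.sum_mul,
    ← Complex.ofReal_sum, ← Finset.sum_div, Finset.sum_neg_distrib, ← Complex.re_sum] at h
  exact h

/-! ### A nondegenerate Gaussian image is an invertible image of the standard Gaussian -/

/-- Factor the positive semidefinite `M * Mᵀ` as `Bᵀ * B` and take `T = Bᵀ`. A kernel vector `t` of
`B` satisfies `|Mᵀ t|² = t ⬝ᵥ M Mᵀ t = 0`, so injectivity of `Mᵀ` makes `B` invertible. -/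
lemma exists_square_factor {n : ℕ} {ι : Type*} [Fintype ι] (M : Matrix (Fin n) ι ℝ)
    (hM : ∀ t, Mᵀ *ᵥ t = 0 → t = 0) :
    ∃ T : Matrix (Fin n) (Fin n) ℝ, T.det ≠ 0 ∧ T * Tᵀ = M * Mᵀ := by
  open scoped MatrixOrder in
  have hS : (M * Mᵀ).PosSemidef := by
    simpa using Matrix.posSemidef_self_mul_conjTranspose M
  obtain ⟨B, hB⟩ := CStarAlgebra.nonneg_iff_eq_star_mul_self.mp hS.nonneg
  rw [Matrix.star_eq_conjTranspose, Matrix.conjTranspose_eq_transpose_of_trivial] at hB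
  refine ⟨Bᵀ, fun h0 => ?_, by rw [Matrix.transpose_transpose, hB]⟩
  obtain ⟨t, ht, ht0⟩ := Matrix.exists_mulVec_eq_zero_iff.mpr (Matrix.det_transpose B ▸ h0)
  refine ht (hM t ?_)
  have h1 : (M * Mᵀ) *ᵥ t = 0 := by rw [hB, ← Matrix.mulVec_mulVec, ht0, Matrix.mulVec_zero]
  rw [← dotProduct_self_eq_zero, Matrix.dotProduct_mulVec, Matrix.vecMul_transpose,
    Matrix.mulVec_mulVec, h1, zero_dotProduct]

lemma dotProduct_transpose_mulVec_self {m ι : Type*} [Fintype m] [Fintype ι] (M : Matrix m ι ℝ)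
    (t : m → ℝ) : (Mᵀ *ᵥ t) ⬝ᵥ (Mᵀ *ᵥ t) = t ⬝ᵥ ((M * Mᵀ) *ᵥ t) := by
  rw [Matrix.dotProduct_mulVec, Matrix.vecMul_transpose, Matrix.mulVec_mulVec, dotProduct_comm]

lemma dotProduct_re_mulVec {n : ℕ} (N : Matrix (Fin n) (Fin (2 * n)) ℂ) (t : Fin n → ℝ)
    (h : Fin (2 * n) → ℂ) :
    (t ⬝ᵥ fun i => ((N *ᵥ h) i).re) = (∑ r, (∑ i, (t i : ℂ) * N i r) * h r).re := by
  simp only [Finset.sum_mul]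
  rw [Finset.sum_comm, Complex.re_sum]
  refine Finset.sum_congr rfl fun i _ => ?_
  simp only [mul_assoc, ← Finset.mul_sum, Complex.re_ofReal_mul]
  rfl

/-- If the noise `Re (N w)` is nondegenerate, its law is the law of `T g`, for an invertible
matrix `T` and a standard Gaussian vector `g`, and `|Tᵀ t| = |Nᵀ t|` for all `t`. -/
lemma exists_map_gaussian_eq {n : ℕ} (N : Matrix (Fin n) (Fin (2 * n)) ℂ)
    (hN : ∀ t : Fin n → ℝ, (∀ r, ∑ i, (t i : ℂ) * N i r = 0) → t = 0) :
    ∃ T : Matrix (Fin n) (Fin n) ℝ, T.det ≠ 0 ∧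
      (∀ t : Fin n → ℝ, (Tᵀ *ᵥ t) ⬝ᵥ (Tᵀ *ᵥ t) = ∑ r, ‖∑ i, (t i : ℂ) * N i r‖ ^ 2) ∧
      (stdComplexNormalVec n).map (fun w i => ((N *ᵥ w) i).re) =
        (Measure.pi fun _ : Fin n => gaussianReal 0 1).map (fun x => T *ᵥ x) := by
  -- Only the covariance `M * Mᵀ` of `Re (N w)` is used, so the sign of the imaginary block is
  -- immaterial.
  set M : Matrix (Fin n) (Fin (2 * n) ⊕ Fin (2 * n)) ℝ :=
    Matrix.of fun i => Sum.elim (fun r => (N i r).re) (fun r => (N i r).im) with hMdef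
  have hre : ∀ t r, (Mᵀ *ᵥ t) (Sum.inl r) = (∑ i, (t i : ℂ) * N i r).re := by
    intro t r
    simp [hMdef, Matrix.mulVec, dotProduct, Complex.re_sum, mul_comm]
  have him : ∀ t r, (Mᵀ *ᵥ t) (Sum.inr r) = (∑ i, (t i : ℂ) * N i r).im := by
    intro t r
    simp [hMdef, Matrix.mulVec, dotProduct, Complex.im_sum, mul_comm]
  obtain ⟨T, hT, hTM⟩ := exists_square_factor M (fun t ht => hN t fun r => by
    apply Complex.ext
    · rw [← hre, ht]; rfl
    · rw [← him, ht]; rfl)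
  have hq : ∀ t : Fin n → ℝ,
      (Tᵀ *ᵥ t) ⬝ᵥ (Tᵀ *ᵥ t) = ∑ r, ‖∑ i, (t i : ℂ) * N i r‖ ^ 2 := by
    intro t
    rw [dotProduct_transpose_mulVec_self, hTM, ← dotProduct_transpose_mulVec_self, dotProduct,
      Fintype.sum_sum_type, ← Finset.sum_add_distrib]
    refine Finset.sum_congr rfl fun r _ => ?_
    rw [hre, him, Complex.sq_norm, Complex.normSq_apply]
  refine ⟨T, hT, hq, ?_⟩
  have hm1 : Measurable (fun (w : Fin (2 * n) → ℂ) i => ((N *ᵥ w) i).re) := by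
    unfold Matrix.mulVec dotProduct; fun_prop
  have hm2 : Measurable (fun x : Fin n → ℝ => T *ᵥ x) := by
    unfold Matrix.mulVec dotProduct; fun_prop
  have := Measure.isProbabilityMeasure_map (μ := stdComplexNormalVec n) hm1.aemeasurable
  have := Measure.isProbabilityMeasure_map
    (μ := Measure.pi fun _ : Fin n => gaussianReal 0 1) hm2.aemeasurable
  -- Both characteristic functions at the functional `L = t ⬝ᵥ ·` equal `exp (-|Tᵀ t|² / 2)`.
  refine Measure.ext_of_charFunDual (funext fun L => ?_)
  set t : Fin n → ℝ := fun i => L (Pi.single i 1) with ht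
  have hL : ∀ x, L x = ∑ i, t i * x i := by
    intro x
    conv_lhs => rw [pi_eq_sum_univ' x]
    simp [ht, map_sum, mul_comm]
  rw [charFunDual_apply, charFunDual_apply, integral_map hm1.aemeasurable (by fun_prop),
    integral_map hm2.aemeasurable (by fun_prop)]
  have e1 := integral_cexp_re_stdComplexNormalVec fun r => ∑ i, (t i : ℂ) * N i r
  have e2 := integral_cexp_pi_gaussianReal (Tᵀ *ᵥ t)
  have e3 : ∑ i, (Tᵀ *ᵥ t) i ^ 2 = ∑ r, ‖∑ i, (t i : ℂ) * N i r‖ ^ 2 := by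
    rw [← hq, dotProduct]; simp only [sq]
  rw [e3, ← e1] at e2
  have e4 : ∀ w : Fin (2 * n) → ℂ,
      (∑ r, (∑ i, (t i : ℂ) * N i r) * w r).re = L (fun i => ((N *ᵥ w) i).re) := by
    intro w
    rw [hL]
    exact (dotProduct_re_mulVec N t w).symm
  have e5 : ∀ x : Fin n → ℝ, ∑ i, (Tᵀ *ᵥ t) i * x i = L (T *ᵥ x) := by
    intro x
    rw [hL]
    change (Tᵀ *ᵥ t) ⬝ᵥ x = t ⬝ᵥ (T *ᵥ x)
    rw [Matrix.dotProduct_mulVec, Matrix.mulVec_transpose]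
  simp only [e4, e5] at e2
  exact e2.symm

/-! ### Densities -/

lemma map_withDensity_comp {α β : Type*} [MeasurableSpace α] [MeasurableSpace β] {μ : Measure α}
    {T : α → β} (hT : Measurable T) {g : β → ℝ≥0∞} (hg : Measurable g) :
    (μ.withDensity (fun x => g (T x))).map T = (μ.map T).withDensity g := by
  ext s hs
  rw [Measure.map_apply hT hs, withDensity_apply _ (hT hs), withDensity_apply _ hs,
    setLIntegral_map hs hg hT]

lemma pi_gaussianReal_eq_withDensity (n : ℕ) :
    Measure.pi (fun _ : Fin n => gaussianReal 0 1) =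
      volume.withDensity fun x => ENNReal.ofReal (∏ i, gaussianPDFReal 0 1 (x i)) := by
  refine Measure.pi_eq fun s hs => ?_
  have hpi : MeasurableSet (Set.univ.pi s) := MeasurableSet.univ_pi hs
  have hfac : ∀ x : Fin n → ℝ, (Set.univ.pi s).indicator
      (fun x => ∏ i, gaussianPDFReal 0 1 (x i)) x =
        ∏ i, (s i).indicator (gaussianPDFReal 0 1) (x i) := by
    intro x
    by_cases hx : x ∈ Set.univ.pi s
    · rw [Set.indicator_of_mem hx]
      exact Finset.prod_congr rfl fun i _ => (Set.indicator_of_mem (hx i trivial) _).symm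
    · rw [Set.indicator_of_notMem hx]
      simp only [Set.mem_pi, Set.mem_univ, true_imp_iff, not_forall] at hx
      obtain ⟨i, hi⟩ := hx
      exact (Finset.prod_eq_zero (Finset.mem_univ i) (Set.indicator_of_notMem hi _)).symm
  have hint : ∀ i, Integrable ((s i).indicator (gaussianPDFReal 0 1)) :=
    fun i => (integrable_gaussianPDFReal 0 1).indicator (hs i)
  have hnn : ∀ i x, 0 ≤ (s i).indicator (gaussianPDFReal 0 1) x :=
    fun i x => Set.indicator_nonneg (fun x _ => gaussianPDFReal_nonneg 0 1 x) x
  rw [withDensity_apply _ hpi, ← lintegral_indicator hpi]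
  have h1 : ∀ x : Fin n → ℝ, (Set.univ.pi s).indicator
      (fun x => ENNReal.ofReal (∏ i, gaussianPDFReal 0 1 (x i))) x =
        ENNReal.ofReal (∏ i, (s i).indicator (gaussianPDFReal 0 1) (x i)) := by
    intro x
    rw [← hfac]
    by_cases hx : x ∈ Set.univ.pi s <;> simp [hx]
  simp only [h1]
  rw [volume_pi, ← ofReal_integral_eq_lintegral_ofReal
      (Integrable.fintype_prod_dep (f := fun i => (s i).indicator (gaussianPDFReal 0 1)) hint)
      (Filter.Eventually.of_forall fun x => Finset.prod_nonneg fun i _ => hnn i _),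
    integral_fintype_prod_eq_prod (fun i => (s i).indicator (gaussianPDFReal 0 1)),
    ENNReal.ofReal_prod_of_nonneg (fun i _ => integral_nonneg (hnn i))]
  refine Finset.prod_congr rfl fun i _ => ?_
  rw [integral_indicator (hs i), gaussianReal_apply_eq_integral _ one_ne_zero]

/-- The law of an invertible image of the standard Gaussian has a Gaussian density. -/
lemma exists_map_gaussian_eq_withDensity {n : ℕ} (T : Matrix (Fin n) (Fin n) ℝ) (hT : T.det ≠ 0) :
    ∃ C : ℝ, 0 < C ∧ (Measure.pi fun _ : Fin n => gaussianReal 0 1).map (fun x => T *ᵥ x) =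
      volume.withDensity fun z =>
        ENNReal.ofReal (C * Real.exp (-((T⁻¹ *ᵥ z) ⬝ᵥ (T⁻¹ *ᵥ z)) / 2)) := by
  have hm : ∀ T : Matrix (Fin n) (Fin n) ℝ, Measurable (fun x : Fin n → ℝ => T *ᵥ x) := by
    intro T; unfold Matrix.mulVec dotProduct; fun_prop
  have hinv : ∀ x, T⁻¹ *ᵥ (T *ᵥ x) = x := fun x => by
    rw [Matrix.mulVec_mulVec, Matrix.nonsing_inv_mul _ (isUnit_iff_ne_zero.mpr hT),
      Matrix.one_mulVec]
  set c : ℝ := (Real.sqrt (2 * Real.pi))⁻¹ with hc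
  have hcpos : 0 < c := by positivity
  have hpdf : ∀ x : Fin n → ℝ,
      ∏ i, gaussianPDFReal 0 1 (x i) = c ^ n * Real.exp (-(x ⬝ᵥ x) / 2) := by
    intro x
    simp only [gaussianPDFReal, NNReal.coe_one, mul_one, sub_zero]
    rw [Finset.prod_mul_distrib, Finset.prod_const, ← Real.exp_sum, ← Finset.sum_div,
      Finset.sum_neg_distrib, Finset.card_univ, Fintype.card_fin]
    simp only [dotProduct, sq, hc]
  have hdet : 0 < |T.det⁻¹| := by positivity
  refine ⟨|T.det⁻¹| * c ^ n, by positivity, ?_⟩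
  rw [pi_gaussianReal_eq_withDensity]
  simp only [hpdf]
  have hg : Measurable fun z : Fin n → ℝ =>
      ENNReal.ofReal (c ^ n * Real.exp (-((T⁻¹ *ᵥ z) ⬝ᵥ (T⁻¹ *ᵥ z)) / 2)) := by
    have := hm T⁻¹
    unfold dotProduct
    fun_prop
  -- The Gaussian density at `x` is written as a function of `T x`, so it passes through the image;
  -- the Jacobian `|T.det⁻¹|` comes from the image of volume.
  have h := map_withDensity_comp (μ := volume) (hm T) hg
  simp only [hinv] at h
  rw [h]
  have hvol := Real.map_matrix_volume_pi_eq_smul_volume_pi hT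
  rw [show ⇑(Matrix.toLin' T) = fun x => T *ᵥ x from rfl] at hvol
  rw [hvol, withDensity_smul_measure,
    ← withDensity_smul _ hg]
  congr 1
  funext z
  rw [Pi.smul_apply, smul_eq_mul, ← ENNReal.ofReal_mul hdet.le, mul_assoc]

/-! ### Rényi divergence of laws with densities -/

/-- Positivity of `g` gives absolute continuity and the Radon–Nikodym derivative `f / g`. The
logarithm of the bound is `(α - 1) * r`, which the prefactor `(α - 1)⁻¹` turns into `r`. -/
lemma renyiDiv_le_of_withDensity {Ω : Type*} [MeasurableSpace Ω] {μ : Measure Ω}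
    {f g : Ω → ℝ} (hf : Measurable f) (hg : Measurable g) (hf0 : ∀ x, 0 < f x)
    (hg0 : ∀ x, 0 < g x)
    [SigmaFinite (μ.withDensity fun x => ENNReal.ofReal (g x))] {α r : ℝ} (hα : 1 < α)
    (h : ∫⁻ x, ENNReal.ofReal ((f x / g x) ^ α * g x) ∂μ ≤ ENNReal.ofReal (Real.exp ((α - 1) * r))) :
    renyiDiv α (μ.withDensity fun x => ENNReal.ofReal (f x))
      (μ.withDensity fun x => ENNReal.ofReal (g x)) ≤ (r : EReal) := by
  set Q := μ.withDensity fun x => ENNReal.ofReal (g x) with hQ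
  have hP : (μ.withDensity fun x => ENNReal.ofReal (f x)) =
      Q.withDensity fun x => ENNReal.ofReal (f x / g x) := by
    rw [hQ, ← withDensity_mul _ (by fun_prop) (by fun_prop)]
    congr 1
    funext x
    rw [Pi.mul_apply, ← ENNReal.ofReal_mul (hg0 x).le, mul_div_cancel₀ _ (hg0 x).ne']
  have hα0 : 0 < α - 1 := sub_pos.mpr hα
  rw [hP, renyiDiv, if_pos (withDensity_absolutelyContinuous _ _)]
  have hint : ∫⁻ ω, ((Q.withDensity fun x => ENNReal.ofReal (f x / g x)).rnDeriv Q ω) ^ α ∂Q ≤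
      ENNReal.ofReal (Real.exp ((α - 1) * r)) := by
    refine le_trans (le_of_eq ?_) h
    have hae : ∀ᵐ ω ∂Q, ((Q.withDensity fun x => ENNReal.ofReal (f x / g x)).rnDeriv Q ω) ^ α =
        ENNReal.ofReal ((f ω / g ω) ^ α) := by
      filter_upwards [Measure.rnDeriv_withDensity Q
        (f := fun x => ENNReal.ofReal (f x / g x)) (by fun_prop)] with ω hω
      rw [hω, ENNReal.ofReal_rpow_of_pos (div_pos (hf0 ω) (hg0 ω))]
    rw [lintegral_congr_ae hae, hQ, lintegral_withDensity_eq_lintegral_mul _ (by fun_prop)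
      (by fun_prop)]
    refine lintegral_congr fun x => ?_
    rw [Pi.mul_apply, ← ENNReal.ofReal_mul (hg0 x).le, mul_comm]
  have hlog := ENNReal.log_le_log hint
  have hexp : ENNReal.log (ENNReal.ofReal (Real.exp ((α - 1) * r))) =
      (((α - 1) * r : ℝ) : EReal) := by
    rw [ENNReal.log_ofReal_of_pos (Real.exp_pos _), Real.log_exp]
  rw [hexp] at hlog
  calc _ ≤ (((α - 1)⁻¹ : ℝ) : EReal) * (((α - 1) * r : ℝ) : EReal) :=
        mul_le_mul_of_nonneg_left hlog (EReal.coe_nonneg.mpr (inv_nonneg.mpr hα0.le))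
    _ = (r : EReal) := by
        rw [← EReal.coe_mul, inv_mul_cancel_left₀ hα0.ne']

/-! ### Transcripts of adaptive streams preserve Lebesgue measure -/

lemma triangular_congr {n : ℕ} {f : (i : Fin n) → (Fin i → ℝ) → ℝ}
    {T : (Fin n → ℝ) → Fin n → ℝ}
    (hT : ∀ z i, T z i = f i (fun l => T z ⟨l, l.2.trans i.2⟩) + z i) {z z' : Fin n → ℝ}
    (i : Fin n) (h : ∀ l ≤ i, z l = z' l) : T z i = T z' i := by
  obtain ⟨i, hi⟩ := i
  induction i using Nat.strong_induction_on with
  | _ i ih =>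
    rw [hT z, hT z', h _ le_rfl]
    congr 2
    funext l
    exact ih l l.2 _ fun k hk => h k (hk.trans (Fin.mk_le_mk.mpr l.2.le))

/-- A triangular perturbation of the identity preserves Lebesgue measure. -/
lemma measurePreserving_of_triangular (n : ℕ) (f : (i : Fin n) → (Fin i → ℝ) → ℝ)
    (hf : ∀ i, Measurable (f i)) (T : (Fin n → ℝ) → Fin n → ℝ)
    (hT : ∀ z i, T z i = f i (fun l => T z ⟨l, l.2.trans i.2⟩) + z i) :
    MeasurePreserving T volume volume := by
  induction n with
  | zero =>
    rw [show T = id from funext fun z => Subsingleton.elim _ _]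
    exact MeasurePreserving.id _
  | succ n ih =>
    -- The padding value `0` is irrelevant: by `triangular_congr` the first `n` outputs do not see
    -- the last coordinate.
    set T' : (Fin n → ℝ) → Fin n → ℝ := fun z i => T (Fin.snoc z 0) i.castSucc with hT'
    have hT'eq : ∀ z i, T z (Fin.castSucc i) = T' (fun i => z i.castSucc) i := fun z i =>
      triangular_congr hT _ fun l hl => by
        obtain ⟨l, rfl⟩ : ∃ l' : Fin n, l = l'.castSucc :=
          ⟨⟨l, lt_of_le_of_lt hl i.2⟩, rfl⟩
        simp
    have ihT : MeasurePreserving T' volume volume := by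
      refine ih (fun i => f i.castSucc) (fun i => hf _) T' fun z i => ?_
      have h := hT (Fin.snoc z 0) i.castSucc
      rw [Fin.snoc_castSucc] at h
      exact h
    let g : (Fin n → ℝ) → ℝ → ℝ := fun a c => f (Fin.last n) (fun l => T' a ⟨l, l.2⟩) + c
    have hg : Measurable (Function.uncurry g) := by
      have h1 : Measurable fun p : (Fin n → ℝ) × ℝ => T' p.1 := ihT.measurable.comp measurable_fst
      refine Measurable.add ((hf _).comp (measurable_pi_lambda _ fun l => ?_)) measurable_snd
      exact measurable_pi_iff.mp h1 ⟨l, l.2⟩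
    -- With the first `n` coordinates fixed, the last one is merely translated, so this is a
    -- measure-preserving skew product.
    have hskew : MeasurePreserving (fun p : (Fin n → ℝ) × ℝ => (T' p.1, g p.1 p.2))
        (volume.prod volume) (volume.prod volume) :=
      ihT.skew_product hg (Filter.Eventually.of_forall fun a => map_add_left_eq_self volume _)
    have he := volume_preserving_piFinSuccAbove (fun _ : Fin (n + 1) => ℝ) (Fin.last n)
    -- `piFinSuccAbove` puts the separated coordinate first and the skew product expects it second,
    -- hence the two swaps.
    have hcomp := (he.symm _).comp ((Measure.measurePreserving_swap.comp hskew).comp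
      (Measure.measurePreserving_swap.comp he))
    refine (funext fun z => ?_ : T = _) ▸ hcomp
    refine (MeasurableEquiv.eq_symm_apply _).mpr (Prod.ext ?_ (funext fun i => ?_))
    · change T z (Fin.last n) = f (Fin.last n) (fun l => T' _ ⟨l, l.2⟩) + z (Fin.last n)
      rw [hT z]
      congr 2
      funext l
      have h := hT'eq z ⟨l, l.2⟩
      refine h.trans ?_
      congr 1
      funext i
      simp [MeasurableEquiv.piFinSuccAbove, Fin.init]
    · change T z ((Fin.last n).succAbove i) = T' (fun i => z ((Fin.last n).succAbove i)) i
      simp only [Fin.succAbove_last]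
      exact hT'eq z i

/-- The prefix sums of the stream that results from the released outputs `y`. -/
def AdaptiveStream.prefixSum {n : ℕ} (a : AdaptiveStream n) (y : Fin n → ℝ) : Fin n → ℝ :=
  fun i => ∑ j ∈ Finset.Iic i, a.streamOn y j

lemma sum_Iic_eq_sum_fin {n : ℕ} (i : Fin n) (x : Fin n → ℝ) :
    ∑ j ∈ Finset.Iic i, x j = ∑ j : Fin ((i : ℕ) + 1), x ⟨j, by omega⟩ := by
  symm
  refine Finset.sum_bij (fun j _ => ⟨j, by omega⟩) (fun j _ => ?_) (fun j _ j' _ h => ?_)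
    (fun j hj => ⟨⟨j, ?_⟩, Finset.mem_univ _, rfl⟩) (fun _ _ => rfl)
  · rw [Finset.mem_Iic, Fin.le_def]; exact Nat.lt_succ_iff.mp j.2
  · exact Fin.ext (Fin.mk.inj_iff.mp h)
  · rw [Finset.mem_Iic, Fin.le_def] at hj; omega

/-- The recursion as a fixed-point equation for the whole transcript `y`: the noise is recovered as
`y - a.prefixSum y`. -/
lemma transcript_eq {n : ℕ} (a : AdaptiveStream n) (z : Fin n → ℝ) (i : Fin n) :
    transcript a z i = a.prefixSum (transcript a z) i + z i := by
  rw [transcript, AdaptiveStream.prefixSum, sum_Iic_eq_sum_fin]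
  rfl

lemma AdaptiveStream.measurable_prefixSum {n : ℕ} (a : AdaptiveStream n) :
    Measurable a.prefixSum :=
  measurable_pi_lambda _ fun _ => Finset.measurable_sum _ fun j _ =>
    (a.measurable_entry j).comp (measurable_pi_lambda _ fun _ => measurable_pi_apply _)

lemma measurePreserving_transcript {n : ℕ} (a : AdaptiveStream n) :
    MeasurePreserving (transcript a) volume volume := by
  refine measurePreserving_of_triangular n (fun i y => ∑ j : Fin ((i : ℕ) + 1),
    a.entry ⟨j, by omega⟩ (fun l : Fin (j : ℕ) => y ⟨l, by omega⟩)) (fun i => ?_) _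
    fun z i => by rw [transcript]
  refine Finset.measurable_sum _ fun j _ => ?_
  exact (a.measurable_entry _).comp (measurable_pi_lambda _ fun _ => measurable_pi_apply _)

/-- The affine combination `α a + (1 - α) a'` of adaptive streams. -/
def AdaptiveStream.affineComb {n : ℕ} (α : ℝ) (a a' : AdaptiveStream n) : AdaptiveStream n where
  entry i y := α * a.entry i y + (1 - α) * a'.entry i y
  measurable_entry i := ((a.measurable_entry i).const_mul α).add
    ((a'.measurable_entry i).const_mul (1 - α))

lemma AdaptiveStream.prefixSum_affineComb {n : ℕ} (α : ℝ) (a a' : AdaptiveStream n)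
    (y : Fin n → ℝ) : (affineComb α a a').prefixSum y =
      α • a.prefixSum y + (1 - α) • a'.prefixSum y := by
  funext i
  simp only [prefixSum, Pi.add_apply, Pi.smul_apply, smul_eq_mul, Finset.mul_sum,
    ← Finset.sum_add_distrib]
  rfl

/-! ### Rényi divergence of adaptive outputs under Gaussian noise -/

section GaussianNoise

variable {n : ℕ} (W : Matrix (Fin n) (Fin n) ℝ) (C : ℝ)

/-- The density of the output on the adaptive stream `a`, for noise of density
`C exp (-|W z|² / 2)`. -/
noncomputable def outputDensity (a : AdaptiveStream n) (y : Fin n → ℝ) : ℝ :=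
  C * Real.exp (-((W *ᵥ (y - a.prefixSum y)) ⬝ᵥ (W *ᵥ (y - a.prefixSum y))) / 2)

lemma measurable_outputDensity (a : AdaptiveStream n) : Measurable (outputDensity W C a) := by
  have h := a.measurable_prefixSum
  have hd : Measurable fun u : Fin n → ℝ => C * Real.exp (-((W *ᵥ u) ⬝ᵥ (W *ᵥ u)) / 2) := by
    unfold Matrix.mulVec dotProduct
    fun_prop
  exact hd.comp (measurable_id.sub h)

lemma outputDensity_transcript (a : AdaptiveStream n) (z : Fin n → ℝ) :
    outputDensity W C a (transcript a z) =
      C * Real.exp (-((W *ᵥ z) ⬝ᵥ (W *ᵥ z)) / 2) := by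
  have h : transcript a z - a.prefixSum (transcript a z) = z := by
    funext i
    rw [Pi.sub_apply, transcript_eq, add_sub_cancel_left]
  rw [outputDensity, h]

lemma map_transcript_eq_withDensity (a : AdaptiveStream n) :
    (volume.withDensity fun z : Fin n → ℝ =>
        ENNReal.ofReal (C * Real.exp (-((W *ᵥ z) ⬝ᵥ (W *ᵥ z)) / 2))).map (transcript a) =
      volume.withDensity fun y => ENNReal.ofReal (outputDensity W C a y) := by
  have h := map_withDensity_comp (measurePreserving_transcript a).measurable
    (μ := volume) (measurable_outputDensity W C a).ennreal_ofReal
  rw [(measurePreserving_transcript a).map_eq] at h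
  rw [← h]
  simp only [outputDensity_transcript]

variable {W C}

/-- With `u`, `u'` the whitened residuals for `a`, `a'`, this is the identity `α|u|² + (1-α)|u'|² =
|αu + (1-α)u'|² - α(α-1)|u - u'|²`, in which `|u - u'|² ≤ 2R`. The residual for `affineComb α a a'`
is `αu + (1-α)u'`. -/
lemma outputDensity_rpow_le (hC : 0 < C) {a a' : AdaptiveStream n} {R α : ℝ} (hα : 1 < α)
    (y : Fin n → ℝ)
    (h : (W *ᵥ (a.prefixSum y - a'.prefixSum y)) ⬝ᵥ (W *ᵥ (a.prefixSum y - a'.prefixSum y)) ≤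
      2 * R) :
    (outputDensity W C a y / outputDensity W C a' y) ^ α * outputDensity W C a' y ≤
      Real.exp ((α - 1) * (R * α)) * outputDensity W C (AdaptiveStream.affineComb α a a') y := by
  have hv : W *ᵥ (y - (AdaptiveStream.affineComb α a a').prefixSum y) =
      α • (W *ᵥ (y - a.prefixSum y)) + (1 - α) • (W *ᵥ (y - a'.prefixSum y)) := by
    rw [AdaptiveStream.prefixSum_affineComb, ← Matrix.mulVec_smul, ← Matrix.mulVec_smul,
      ← Matrix.mulVec_add]
    congr 1
    module
  have hd : W *ᵥ (a.prefixSum y - a'.prefixSum y) =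
      W *ᵥ (y - a'.prefixSum y) - W *ᵥ (y - a.prefixSum y) := by
    rw [← Matrix.mulVec_sub]
    congr 1
    abel
  rw [hd] at h
  unfold outputDensity
  rw [hv]
  set u := W *ᵥ (y - a.prefixSum y)
  set u' := W *ᵥ (y - a'.prefixSum y)
  rw [mul_div_mul_left _ _ hC.ne', ← Real.exp_sub, ← Real.exp_mul, mul_left_comm,
    mul_left_comm (Real.exp ((α - 1) * (R * α))),
    ← Real.exp_add, ← Real.exp_add]
  refine mul_le_mul_of_nonneg_left (Real.exp_le_exp.mpr ?_) hC.le
  simp only [dotProduct_sub, sub_dotProduct, dotProduct_add, add_dotProduct, dotProduct_smul,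
    smul_dotProduct, smul_eq_mul] at h ⊢
  rw [dotProduct_comm u' u] at h ⊢
  nlinarith [mul_le_mul_of_nonneg_left h
    (mul_nonneg (sub_nonneg.mpr hα.le) (zero_le_one.trans hα.le))]

/-- The Rényi divergence of the outputs on two adaptive streams, for nondegenerate Gaussian noise
that is independent of the streams. -/
lemma renyiDiv_map_transcript_le (hC : 0 < C) {ν : Measure (Fin n → ℝ)} [IsProbabilityMeasure ν]
    (hν : ν = volume.withDensity fun z =>
      ENNReal.ofReal (C * Real.exp (-((W *ᵥ z) ⬝ᵥ (W *ᵥ z)) / 2)))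
    {a a' : AdaptiveStream n} {R α : ℝ} (hα : 1 < α)
    (h : ∀ y, (W *ᵥ (a.prefixSum y - a'.prefixSum y)) ⬝ᵥ
      (W *ᵥ (a.prefixSum y - a'.prefixSum y)) ≤ 2 * R) :
    renyiDiv α (ν.map (transcript a)) (ν.map (transcript a')) ≤ ((R * α : ℝ) : EReal) := by
  have hlaw : ∀ b : AdaptiveStream n, ν.map (transcript b) =
      volume.withDensity fun y => ENNReal.ofReal (outputDensity W C b y) := fun b => by
    rw [hν, map_transcript_eq_withDensity]
  have hprob : ∀ b : AdaptiveStream n, IsProbabilityMeasure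
      (volume.withDensity fun y => ENNReal.ofReal (outputDensity W C b y)) := fun b =>
    hlaw b ▸ Measure.isProbabilityMeasure_map
      (measurePreserving_transcript b).measurable.aemeasurable
  have hpos : ∀ (b : AdaptiveStream n) y, 0 < outputDensity W C b y :=
    fun b y => mul_pos hC (Real.exp_pos _)
  rw [hlaw, hlaw]
  have := hprob a'
  refine renyiDiv_le_of_withDensity (measurable_outputDensity W C a)
    (measurable_outputDensity W C a') (hpos a) (hpos a') hα ?_
  -- Although `α > 1`, the affine combination is again an adaptive stream, so this is a probability
  -- density. The shift may thus depend on `y`.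
  have h1 : ∫⁻ y, ENNReal.ofReal (outputDensity W C (AdaptiveStream.affineComb α a a') y) = 1 := by
    have := (hprob (AdaptiveStream.affineComb α a a')).measure_univ
    rwa [withDensity_apply _ MeasurableSet.univ, Measure.restrict_univ] at this
  calc _ ≤ ∫⁻ y, ENNReal.ofReal (Real.exp ((α - 1) * (R * α))) *
        ENNReal.ofReal (outputDensity W C (AdaptiveStream.affineComb α a a') y) :=
        lintegral_mono fun y => by
          rw [← ENNReal.ofReal_mul (Real.exp_pos _).le]
          exact ENNReal.ofReal_le_ofReal (outputDensity_rpow_le hC hα y (h y))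
    _ = _ := by
        rw [lintegral_const_mul _ (measurable_outputDensity W C _).ennreal_ofReal, h1, mul_one]

end GaussianNoise

/-! ### Diagonalisation of the circulant embedding -/

lemma sum_exp_eq_ite (N : ℕ) (hN : 0 < N) (m : ℤ) :
    ∑ r : Fin N, Complex.exp (2 * Real.pi * Complex.I * ((r : ℕ) * m) / N) =
      if (N : ℤ) ∣ m then (N : ℂ) else 0 := by
  have hN0 : (N : ℂ) ≠ 0 := Nat.cast_ne_zero.mpr hN.ne'
  set ζ : ℂ := Complex.exp (2 * Real.pi * Complex.I * m / N) with hζ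
  have hpow : ∀ r : ℕ, Complex.exp (2 * Real.pi * Complex.I * (r * m) / N) = ζ ^ r := fun r => by
    rw [hζ, ← Complex.exp_nat_mul]
    congr 1
    ring
  have hζ1 : ζ = 1 ↔ (N : ℤ) ∣ m := by
    rw [hζ, Complex.exp_eq_one_iff]
    constructor
    · rintro ⟨q, hq⟩
      refine ⟨q, ?_⟩
      have h2 : (2 * Real.pi * Complex.I : ℂ) ≠ 0 := Complex.two_pi_I_ne_zero
      rw [div_eq_iff hN0] at hq
      have h3 : (m : ℂ) = N * q := mul_left_cancel₀ h2 (by rw [hq]; ring)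
      exact_mod_cast h3
    · rintro ⟨q, rfl⟩
      refine ⟨q, ?_⟩
      push_cast
      field_simp
  simp only [hpow]
  rw [Fin.sum_univ_eq_sum_range (fun r => ζ ^ r) N]
  split_ifs with h
  · simp [hζ1.mpr h]
  · have hζN : ζ ^ N = 1 := by
      rw [← hpow, Complex.exp_eq_one_iff]
      exact ⟨m, by field_simp⟩
    rw [geom_sum_eq (fun h1 => h (hζ1.mp h1)), hζN, sub_self, zero_div]

lemma sqrtSigma_mul_self (n : ℕ) :
    sqrtSigma n * sqrtSigma n = Matrix.diagonal (vDFT n) := by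
  rw [sqrtSigma, Matrix.diagonal_mul_diagonal]
  congr 1
  funext k
  rw [← sq, show (1 / 2 : ℂ) = ((2 : ℕ) : ℂ)⁻¹ by norm_num, Complex.cpow_nat_inv_pow _ two_ne_zero]

lemma conj_dftMatrix_mul_exp_mul_dftMatrix {n : ℕ} (hn : 0 < n) (a b j r : Fin (2 * n)) :
    star (dftMatrix n r a) *
      Complex.exp (-(Complex.I * 2 * Real.pi * (r : ℕ) * (j : ℕ)) / (2 * n)) * dftMatrix n r b =
      (2 * n : ℂ)⁻¹ * Complex.exp (2 * Real.pi * Complex.I *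
        ((r : ℕ) * (((a : ℕ) - (j : ℕ) - (b : ℕ) : ℤ) : ℂ)) / ((2 * n : ℕ) : ℂ)) := by
  have hs : ((1 / Real.sqrt (2 * n) : ℝ) : ℂ) * ((1 / Real.sqrt (2 * n) : ℝ) : ℂ) =
      (2 * n : ℂ)⁻¹ := by
    rw [← Complex.ofReal_mul, one_div, ← mul_inv, Real.mul_self_sqrt (by positivity)]
    push_cast
    rfl
  have hc : star (Complex.exp (-(Complex.I * 2 * Real.pi * (r : ℕ) * (a : ℕ)) / (2 * n))) =
      Complex.exp ((Complex.I * 2 * Real.pi * (r : ℕ) * (a : ℕ)) / (2 * n)) := by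
    rw [Complex.star_def, ← Complex.exp_conj]
    congr 1
    simp [map_ofNat]
  simp only [dftMatrix, Matrix.of_apply, star_mul', hc]
  rw [Complex.star_def, Complex.conj_ofReal, ← hs]
  have he : Complex.exp (2 * Real.pi * Complex.I *
        ((r : ℕ) * (((a : ℕ) - (j : ℕ) - (b : ℕ) : ℤ) : ℂ)) / ((2 * n : ℕ) : ℂ)) =
      Complex.exp ((Complex.I * 2 * Real.pi * (r : ℕ) * (a : ℕ)) / (2 * n)) *
      Complex.exp (-(Complex.I * 2 * Real.pi * (r : ℕ) * (j : ℕ)) / (2 * n)) *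
      Complex.exp (-(Complex.I * 2 * Real.pi * (r : ℕ) * (b : ℕ)) / (2 * n)) := by
    rw [← Complex.exp_add, ← Complex.exp_add]
    congr 1
    push_cast
    ring
  rw [he]
  ring

/-- Subtraction in `Fin N` is modular. The integer `a - j - b`, after adding `N` when `a < b`, lies
strictly between `-N` and `N`, so divisibility forces it to be `0`. -/
lemma dvd_sub_iff_eq_sub {N : ℕ} (a b j : Fin N) :
    (N : ℤ) ∣ ((a : ℕ) - (j : ℕ) - (b : ℕ) : ℤ) ↔ j = a - b := by
  have ha := a.2
  have hb := b.2
  have hj := j.2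
  rw [Fin.ext_iff, Fin.val_sub]
  rcases le_or_gt (b : ℕ) a with h | h
  · rw [show N - (b : ℕ) + a = (a - b) + N by omega, Nat.add_mod_right,
      Nat.mod_eq_of_lt (by omega)]
    constructor
    · intro hd
      have := Int.eq_zero_of_abs_lt_dvd hd (by rw [abs_lt]; omega)
      omega
    · intro he
      rw [show ((a : ℕ) - (j : ℕ) - (b : ℕ) : ℤ) = 0 by omega]
      exact dvd_zero _
  · rw [Nat.mod_eq_of_lt (by omega)]
    constructor
    · intro hd
      have hd' := dvd_add hd (dvd_refl (N : ℤ))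
      have := Int.eq_zero_of_abs_lt_dvd hd' (by rw [abs_lt]; omega)
      omega
    · intro he
      rw [show ((a : ℕ) - (j : ℕ) - (b : ℕ) : ℤ) = -N by omega]
      exact (dvd_refl _).neg_right

theorem circMatrix_eq_decoder_mul_encoder {n : ℕ} (hn : 0 < n) :
    (circMatrix n).map Complex.ofReal = decoder n * encoder n := by
  have hn0 : ((2 * n : ℕ) : ℂ) ≠ 0 := Nat.cast_ne_zero.mpr (by omega)
  ext a b
  rw [decoder, encoder, Matrix.mul_assoc, ← Matrix.mul_assoc (sqrtSigma n), sqrtSigma_mul_self,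
    Matrix.map_apply, circMatrix, Matrix.circulant_apply, Matrix.mul_apply]
  simp only [Matrix.diagonal_mul, Matrix.conjTranspose_apply, vDFT, Finset.sum_mul, Finset.mul_sum]
  rw [Finset.sum_comm]
  have h : ∀ j r : Fin (2 * n), star (dftMatrix n r a) *
      ((embVec n j : ℂ) * Complex.exp (-(Complex.I * 2 * Real.pi * (r : ℕ) * (j : ℕ)) / (2 * n)) *
        dftMatrix n r b) =
      (embVec n j : ℂ) * (2 * n : ℂ)⁻¹ * Complex.exp (2 * Real.pi * Complex.I *
        ((r : ℕ) * (((a : ℕ) - (j : ℕ) - (b : ℕ) : ℤ) : ℂ)) / ((2 * n : ℕ) : ℂ)) := by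
    intro j r
    rw [mul_assoc (embVec n j : ℂ) (2 * n : ℂ)⁻¹, ← conj_dftMatrix_mul_exp_mul_dftMatrix hn]
    ring
  simp only [h, ← Finset.mul_sum]
  simp only [sum_exp_eq_ite (2 * n) (by omega), dvd_sub_iff_eq_sub]
  -- Orthogonality of the characters leaves only the term `j = a - b`, the circulant entry.
  rw [Finset.sum_eq_single (a - b) (fun j _ hj => by rw [if_neg hj, mul_zero])
    (fun h => absurd (Finset.mem_univ _) h), if_pos rfl]
  push_cast at hn0 ⊢
  rw [mul_assoc, inv_mul_cancel₀ hn0, mul_one]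

/-- For `i < j` the difference wraps around to `2n - (j - i) > n`, inside the zero half of `v`; this
is why the embedding doubles the length. -/
theorem circMatrix_submatrix_firstHalf (n : ℕ) :
    (circMatrix n).submatrix firstHalf firstHalf = prefixSumMatrix n := by
  ext i j
  have hi := i.2
  have hj := j.2
  have h : ((firstHalf i - firstHalf j : Fin (2 * n)) : ℕ) < n ↔ j ≤ i := by
    rw [Fin.val_sub, Fin.le_def]
    simp only [firstHalf, Fin.val_castLE]
    rcases le_or_gt (j : ℕ) i with h | h
    · rw [show 2 * n - (j : ℕ) + i = (i - j) + 2 * n by omega, Nat.add_mod_right,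
        Nat.mod_eq_of_lt (by omega)]
      omega
    · rw [Nat.mod_eq_of_lt (by omega)]
      omega
  simp only [Matrix.submatrix_apply, circMatrix, Matrix.circulant_apply, prefixSumMatrix,
    Matrix.of_apply, embVec, h]

lemma sum_decoder_mul_encoder {n : ℕ} (hn : 0 < n) (i j : Fin n) :
    ∑ r, decoder n (firstHalf i) r * encoder n r (firstHalf j) =
      if j ≤ i then 1 else 0 := by
  rw [← Matrix.mul_apply, ← circMatrix_eq_decoder_mul_encoder hn, Matrix.map_apply,
    ← Matrix.submatrix_apply (circMatrix n) firstHalf firstHalf, circMatrix_submatrix_firstHalf]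
  simp only [prefixSumMatrix, Matrix.of_apply]
  split_ifs <;> simp

/-- If the transform vanished, so would the encoder, yet decoder times encoder has entry `1` at `(0,
0)`. -/
lemma sum_norm_vDFT_pos {n : ℕ} (hn : 0 < n) : 0 < ∑ k, ‖vDFT n k‖ := by
  refine (Finset.sum_nonneg fun _ _ => norm_nonneg _).lt_of_ne' fun h => ?_
  have h0 : ∀ k, vDFT n k = 0 := fun k =>
    norm_eq_zero.mp ((Finset.sum_eq_zero_iff_of_nonneg fun _ _ => norm_nonneg _).mp h k
      (Finset.mem_univ k))
  have h1 := sum_decoder_mul_encoder hn ⟨0, hn⟩ ⟨0, hn⟩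
  simp [encoder, sqrtSigma, h0] at h1

lemma noiseScale_pos {n : ℕ} (hn : 0 < n) {κ ρ : ℝ} (hκ : 0 < κ) (hρ : 0 < ρ) :
    0 < noiseScale n κ ρ := by
  have h1 := sum_norm_vDFT_pos hn
  have h2 : (0 : ℝ) < n := Nat.cast_pos.mpr hn
  exact Real.sqrt_pos.mpr (by positivity)

/-- The modulus does not depend on the column, so the sensitivity bound sees a stream difference `δ`
only through `∑ |δ j|`, whatever the participation pattern. -/
lemma norm_encoder_sq {n : ℕ} (r a : Fin (2 * n)) :
    ‖encoder n r a‖ ^ 2 = ‖vDFT n r‖ / (2 * n) := by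
  have h1 : ‖vDFT n r ^ (1 / 2 : ℂ)‖ ^ 2 = ‖vDFT n r‖ := by
    rw [← norm_pow, show (1 / 2 : ℂ) = ((2 : ℕ) : ℂ)⁻¹ by norm_num,
      Complex.cpow_nat_inv_pow _ two_ne_zero]
  have h2 : ‖Complex.exp (-(Complex.I * 2 * Real.pi * (r : ℕ) * (a : ℕ)) / (2 * n))‖ = 1 := by
    rw [show -(Complex.I * 2 * Real.pi * (r : ℕ) * (a : ℕ)) / (2 * n) =
      ((-(2 * Real.pi * (r : ℕ) * (a : ℕ)) / (2 * n) : ℝ) : ℂ) * Complex.I by push_cast; ring,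
      Complex.norm_exp_ofReal_mul_I]
  rw [encoder, sqrtSigma, Matrix.diagonal_mul, dftMatrix, Matrix.of_apply, norm_mul, norm_mul, h2,
    mul_one, mul_pow, h1, Complex.norm_real, Real.norm_eq_abs, sq_abs, div_pow, one_pow,
    Real.sq_sqrt (by positivity), mul_one_div]

/-! ### The noise of the mechanism and its sensitivity -/

/-- The complex matrix whose product with `w` has the noise as its real part. -/
noncomputable def noiseMatrix (n : ℕ) (κ ρ : ℝ) : Matrix (Fin n) (Fin (2 * n)) ℂ :=
  Matrix.of fun i r => (noiseScale n κ ρ : ℂ) * decoder n (firstHalf i) r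

lemma fftNoise_eq (n : ℕ) (κ ρ : ℝ) :
    fftNoise n κ ρ = fun w i => ((noiseMatrix n κ ρ *ᵥ w) i).re := by
  funext w i
  simp only [fftNoise, noiseMatrix, Matrix.mulVec, dotProduct, Matrix.of_apply, Finset.mul_sum,
    mul_assoc]

lemma measurable_fftNoise (n : ℕ) (κ ρ : ℝ) : Measurable (fftNoise n κ ρ) := by
  rw [fftNoise_eq]
  unfold Matrix.mulVec dotProduct
  fun_prop

/-- The shift of `w` that has the same effect as adding `δ` to the stream. -/
noncomputable def streamShift (n : ℕ) (κ ρ : ℝ) (δ : Fin n → ℝ) : Fin (2 * n) → ℂ :=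
  fun r => (noiseScale n κ ρ : ℂ)⁻¹ * ∑ j, encoder n r (firstHalf j) * δ j

lemma noiseMatrix_mulVec_streamShift {n : ℕ} (hn : 0 < n) {κ ρ : ℝ} (hκ : 0 < κ) (hρ : 0 < ρ)
    (δ : Fin n → ℝ) (i : Fin n) :
    (noiseMatrix n κ ρ *ᵥ streamShift n κ ρ δ) i = ((∑ j ∈ Finset.Iic i, δ j : ℝ) : ℂ) := by
  have hc : (noiseScale n κ ρ : ℂ) ≠ 0 :=
    Complex.ofReal_ne_zero.mpr (noiseScale_pos hn hκ hρ).ne'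
  simp only [noiseMatrix, streamShift, Matrix.mulVec, dotProduct, Matrix.of_apply]
  have h : ∀ r, (noiseScale n κ ρ : ℂ) * decoder n (firstHalf i) r *
      ((noiseScale n κ ρ : ℂ)⁻¹ * ∑ j, encoder n r (firstHalf j) * δ j) =
      ∑ j, decoder n (firstHalf i) r * encoder n r (firstHalf j) * δ j := fun r => by
    rw [mul_mul_mul_comm, mul_inv_cancel₀ hc, one_mul, Finset.mul_sum]
    simp only [mul_assoc]
  simp only [h]
  rw [Finset.sum_comm]
  simp only [← Finset.sum_mul, sum_decoder_mul_encoder hn, ite_mul, one_mul, zero_mul]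
  rw [← Finset.sum_filter, Complex.ofReal_sum]
  refine Finset.sum_congr ?_ fun _ _ => rfl
  ext j
  simp

lemma exists_sum_Iic_eq {n : ℕ} (t : Fin n → ℝ) :
    ∃ δ : Fin n → ℝ, ∀ i, ∑ j ∈ Finset.Iic i, δ j = t i := by
  have hdet : (prefixSumMatrix n).det = 1 := by
    rw [Matrix.det_of_isLowerTriangular]
    · simp [prefixSumMatrix]
    · intro i j hij
      simp only [OrderDual.toDual_lt_toDual] at hij
      simp [prefixSumMatrix, hij]
  refine ⟨(prefixSumMatrix n)⁻¹ *ᵥ t, fun i => ?_⟩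
  have h : prefixSumMatrix n *ᵥ ((prefixSumMatrix n)⁻¹ *ᵥ t) = t := by
    rw [Matrix.mulVec_mulVec, Matrix.mul_nonsing_inv _ (by simp [hdet]), Matrix.one_mulVec]
  have hi := congrFun h i
  rw [← hi, Matrix.mulVec, dotProduct]
  simp only [prefixSumMatrix, Matrix.of_apply, ite_mul, one_mul, zero_mul]
  rw [← Finset.sum_filter]
  refine Finset.sum_congr ?_ fun _ _ => rfl
  ext j
  simp

/-- The noise map reaches every real vector: `t` is the prefix sum of some `δ`, hence the image of a
stream shift. Pairing with `t` gives `t ⬝ᵥ t = 0`. -/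
lemma noiseMatrix_nondegenerate {n : ℕ} (hn : 0 < n) {κ ρ : ℝ} (hκ : 0 < κ) (hρ : 0 < ρ)
    (t : Fin n → ℝ) (ht : ∀ r, ∑ i, (t i : ℂ) * noiseMatrix n κ ρ i r = 0) : t = 0 := by
  obtain ⟨δ, hδ⟩ := exists_sum_Iic_eq t
  have h := dotProduct_re_mulVec (noiseMatrix n κ ρ) t (streamShift n κ ρ δ)
  simp only [noiseMatrix_mulVec_streamShift hn hκ hρ, Complex.ofReal_re, hδ, ht, zero_mul,
    Finset.sum_const_zero, Complex.zero_re] at h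
  exact dotProduct_self_eq_zero.mp h

/-- Whitening does not increase norms, compared with any preimage under the noise map. -/
lemma whitened_le {n : ℕ} {N : Matrix (Fin n) (Fin (2 * n)) ℂ} {T : Matrix (Fin n) (Fin n) ℝ}
    (hT : T.det ≠ 0)
    (hTN : ∀ t : Fin n → ℝ, (Tᵀ *ᵥ t) ⬝ᵥ (Tᵀ *ᵥ t) = ∑ r, ‖∑ i, (t i : ℂ) * N i r‖ ^ 2)
    (h : Fin (2 * n) → ℂ) :
    (T⁻¹ *ᵥ fun i => ((N *ᵥ h) i).re) ⬝ᵥ (T⁻¹ *ᵥ fun i => ((N *ᵥ h) i).re) ≤ ∑ r, ‖h r‖ ^ 2 := by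
  set e := T⁻¹ *ᵥ fun i => ((N *ᵥ h) i).re with he
  -- The dual vector of `e`: `|e|²` equals both `t ⬝ᵥ Re (N h)` and `|Nᵀ t|²`, so Cauchy–Schwarz
  -- gives `|e|⁴ ≤ |e|² |h|²`.
  set t := (T⁻¹)ᵀ *ᵥ e with ht
  have hTt : Tᵀ *ᵥ t = e := by
    rw [ht, Matrix.mulVec_mulVec, ← Matrix.transpose_mul,
      Matrix.nonsing_inv_mul _ (isUnit_iff_ne_zero.mpr hT), Matrix.transpose_one,
      Matrix.one_mulVec]
  have hb := hTN t
  rw [hTt] at hb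
  have h1 : e ⬝ᵥ e = (∑ r, (∑ i, (t i : ℂ) * N i r) * h r).re := by
    rw [← dotProduct_re_mulVec, ht, Matrix.mulVec_transpose, ← Matrix.dotProduct_mulVec]
  have h0 : 0 ≤ e ⬝ᵥ e := by rw [hb]; positivity
  have h2 : e ⬝ᵥ e ≤ ∑ r, ‖∑ i, (t i : ℂ) * N i r‖ * ‖h r‖ := by
    rw [h1]
    refine (Complex.re_le_norm _).trans ((norm_sum_le _ _).trans (le_of_eq ?_))
    simp only [norm_mul]
  have h3 := Finset.sum_mul_sq_le_sq_mul_sq Finset.univ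
    (fun r => ‖∑ i, (t i : ℂ) * N i r‖) (fun r => ‖h r‖)
  rw [← hb] at h3
  have h4 : (e ⬝ᵥ e) ^ 2 ≤ (e ⬝ᵥ e) * ∑ r, ‖h r‖ ^ 2 := (pow_le_pow_left₀ h0 h2 2).trans h3
  rcases h0.eq_or_lt with h5 | h5
  · rw [← h5]; positivity
  · exact le_of_mul_le_mul_left (by rwa [sq] at h4) h5

lemma sum_abs_le_of_neighboringStreams {n : ℕ} {κ : ℝ} (hκ : 0 < κ) {k : ℕ}
    {Pi : Set (Finset (Fin n))} (hPi : ∀ π ∈ Pi, π.card ≤ k) {x x' : Fin n → ℝ}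
    (h : NeighboringStreams Pi κ x x') : ∑ j, |x j - x' j| ≤ k * κ := by
  obtain ⟨π, hπ, h0, h1⟩ := h
  calc ∑ j, |x j - x' j| = ∑ j ∈ π, |x j - x' j| :=
        (Finset.sum_subset (Finset.subset_univ π) fun j _ hj => by
          rw [h0 j hj, sub_self, abs_zero]).symm
    _ ≤ π.card * κ := by simpa using Finset.sum_le_card_nsmul π _ κ h1
    _ ≤ k * κ := mul_le_mul_of_nonneg_right (Nat.cast_le.mpr (hPi π hπ)) hκ.le

/-- The noise scale is calibrated here: `4nρ / (κ² ‖v̂‖₁) · ‖v̂‖₁ / (2n) · (kκ)² = 2k²ρ`. The `2`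
cancels the `1/2` of the Gaussian Rényi divergence. -/
lemma sum_norm_streamShift_sq_le {n : ℕ} (hn : 0 < n) {κ ρ : ℝ} (hκ : 0 < κ) (hρ : 0 < ρ) {k : ℕ}
    {δ : Fin n → ℝ} (hδ : ∑ j, |δ j| ≤ k * κ) :
    ∑ r, ‖streamShift n κ ρ δ r‖ ^ 2 ≤ 2 * ((k : ℝ) ^ 2 * ρ) := by
  have hV := sum_norm_vDFT_pos hn
  have hn' : (0 : ℝ) < n := Nat.cast_pos.mpr hn
  have hc : noiseScale n κ ρ ^ 2 = κ ^ 2 * (∑ k, ‖vDFT n k‖) / (4 * n * ρ) :=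
    Real.sq_sqrt (by positivity)
  have hr : ∀ r, ‖streamShift n κ ρ δ r‖ ^ 2 ≤
      (noiseScale n κ ρ ^ 2)⁻¹ * (‖vDFT n r‖ / (2 * n) * (k * κ) ^ 2) := by
    intro r
    have hs : ‖∑ j, encoder n r (firstHalf j) * δ j‖ ≤
        Real.sqrt (‖vDFT n r‖ / (2 * n)) * (k * κ) := by
      refine (norm_sum_le _ _).trans ?_
      have he : ∀ j : Fin n, ‖encoder n r (firstHalf j) * δ j‖ =
          Real.sqrt (‖vDFT n r‖ / (2 * n)) * |δ j| := fun j => by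
        rw [norm_mul, ← norm_encoder_sq r (firstHalf j), Real.sqrt_sq (norm_nonneg _),
          Complex.norm_real, Real.norm_eq_abs]
      simp only [he, ← Finset.mul_sum]
      exact mul_le_mul_of_nonneg_left hδ (Real.sqrt_nonneg _)
    rw [streamShift, norm_mul, mul_pow, norm_inv, inv_pow, Complex.norm_real, Real.norm_eq_abs,
      sq_abs]
    refine mul_le_mul_of_nonneg_left ?_ (by positivity)
    refine (pow_le_pow_left₀ (norm_nonneg _) hs 2).trans (le_of_eq ?_)
    rw [mul_pow, Real.sq_sqrt (by positivity)]
  refine (Finset.sum_le_sum fun r _ => hr r).trans (le_of_eq ?_)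
  rw [← Finset.mul_sum, ← Finset.sum_mul, ← Finset.sum_div, hc]
  field_simp
  ring

/-! ### Privacy -/

theorem isZCDP_adaptiveFFTMechanism {n : ℕ} (hn : 0 < n) {κ ρ : ℝ} (hκ : 0 < κ) (hρ : 0 < ρ)
    {k : ℕ} {Pi : Set (Finset (Fin n))} (hPi : ∀ π ∈ Pi, π.card ≤ k) :
    IsZCDP (NeighboringAdaptiveStreams Pi κ) (adaptiveFFTMechanism n κ ρ) ((k : ℝ) ^ 2 * ρ) := by
  intro a a' haa' α hα
  obtain ⟨T, hT, hTN, hlaw⟩ := exists_map_gaussian_eq (noiseMatrix n κ ρ)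
    (noiseMatrix_nondegenerate hn hκ hρ)
  obtain ⟨C, hC, hdens⟩ := exists_map_gaussian_eq_withDensity T hT
  rw [← fftNoise_eq, hdens] at hlaw
  have hm := measurable_fftNoise n κ ρ
  have := Measure.isProbabilityMeasure_map (μ := stdComplexNormalVec n) hm.aemeasurable
  have hadapt : ∀ b : AdaptiveStream n, adaptiveFFTMechanism n κ ρ b =
      ((stdComplexNormalVec n).map (fftNoise n κ ρ)).map (transcript b) := fun b =>
    (Measure.map_map (measurePreserving_transcript b).measurable hm).symm
  rw [hadapt, hadapt]
  refine renyiDiv_map_transcript_le hC hlaw hα fun y => ?_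
  -- The outputs `y` are fixed and both streams are evaluated on them, so the neighbouring relation
  -- applies pointwise in `y`.
  set δ : Fin n → ℝ := fun j => a.streamOn y j - a'.streamOn y j with hδ
  have hd : a.prefixSum y - a'.prefixSum y =
      fun i => ((noiseMatrix n κ ρ *ᵥ streamShift n κ ρ δ) i).re := by
    funext i
    rw [noiseMatrix_mulVec_streamShift hn hκ hρ, Complex.ofReal_re, hδ, Finset.sum_sub_distrib]
    rfl
  rw [hd]
  exact (whitened_le hT hTN _).trans (sum_norm_streamShift_sq_le hn hκ hρ
    (sum_abs_le_of_neighboringStreams hκ hPi (haa' y)))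

/-- A stream that is fixed in advance, as an adaptive stream. -/
def AdaptiveStream.const {n : ℕ} (x : Fin n → ℝ) : AdaptiveStream n where
  entry i _ := x i
  measurable_entry _ := measurable_const

lemma fftMechanism_eq_adaptive (n : ℕ) (κ ρ : ℝ) (x : Fin n → ℝ) :
    fftMechanism n κ ρ x = adaptiveFFTMechanism n κ ρ (AdaptiveStream.const x) := by
  rw [fftMechanism, adaptiveFFTMechanism]
  congr 1
  funext w i
  rw [transcript_eq]
  rfl

end FFTPrefixSum

theorem mainTheorem7 (n : ℕ) (hn : 0 < n) (κ ρ : ℝ) (hκ : 0 < κ) (hρ : 0 < ρ) (k : ℕ)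
    (Pi : Set (Finset (Fin n))) (hPi : ∀ π ∈ Pi, π.card ≤ k) :
    (FFTPrefixSum.circMatrix n).map Complex.ofReal =
        FFTPrefixSum.decoder n * FFTPrefixSum.encoder n ∧
      (FFTPrefixSum.circMatrix n).submatrix FFTPrefixSum.firstHalf FFTPrefixSum.firstHalf =
        FFTPrefixSum.prefixSumMatrix n ∧
      FFTPrefixSum.IsZCDP (FFTPrefixSum.NeighboringStreams Pi κ)
        (FFTPrefixSum.fftMechanism n κ ρ) ((k : ℝ) ^ 2 * ρ) ∧
      FFTPrefixSum.IsZCDP (FFTPrefixSum.NeighboringAdaptiveStreams Pi κ)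
        (FFTPrefixSum.adaptiveFFTMechanism n κ ρ) ((k : ℝ) ^ 2 * ρ) := by
  refine ⟨FFTPrefixSum.circMatrix_eq_decoder_mul_encoder hn,
    FFTPrefixSum.circMatrix_submatrix_firstHalf n, fun x x' h α hα => ?_,
    FFTPrefixSum.isZCDP_adaptiveFFTMechanism hn hκ hρ hPi⟩
  rw [FFTPrefixSum.fftMechanism_eq_adaptive, FFTPrefixSum.fftMechanism_eq_adaptive]
  exact FFTPrefixSum.isZCDP_adaptiveFFTMechanism hn hκ hρ hPi
    (FFTPrefixSum.AdaptiveStream.const x) (FFTPrefixSum.AdaptiveStream.const x') (fun _ => h) α hα
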